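/- Let $\mathscr P$ be a finite non-empty set of processes and let $\{\Sigma_i\}_{i\in\mathscr P}$ be a distributed alphabet, i.e. a family of non-empty finite sets; put $\Sigma=\bigcup_i\Sigma_i$ and $\mathrm{loc}(a)=\{i\mid a\in\Sigma_i\}$ for $a\in\Sigma$. The trace monoid $\mathrm{Tr}$ is the quotient of the free monoid $\Sigma^*$ by the congruence generated by $ab=ba$ for all $a,b$ with $\mathrm{loc}(a)\cap\mathrm{loc}(b)=\emptyset$. The communication graph has vertex set $\mathscr P$, with distinct $i,j$ adjacent iff $\Sigma_i\cap\Sigma_j\neq\emptyset$. For a set $X$, let $\mathcal F(X)$ be the monoid of all maps $X\to X$, with product $fg=g\circ f$. A finite transformation monoid (tm) is a pair $(X,M)$ with $X$ a finite non-empty set and $M$ a submonoid of $\mathcal F(X)$. An asynchronous transformation monoid (atm) is a pair $(\{S_i\}_{i\in\mathscr P},M)$ where the $S_i$ are finite non-empty sets and $M$ is a submonoid of $\mathcal F(S)$, $S=\prod_{i}S_i$. For $P\subseteq\mathscr P$, a map $g\in\mathcal F(S)$ is a $P$-map if there is a transformation $f$ of $\prod_{i\in P}S_i$ such that, for all $s\in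 S$, $g(s)|_P=f(s|_P)$ and $g(s)_i=s_i$ for $i\notin P$. A morphism $\psi\colon\mathrm{Tr}\to M$ is asynchronous if $\psi(a)$ is a $\mathrm{loc}(a)$-map for every $a\in\Sigma$. It simulates a morphism $\varphi\colon\mathrm{Tr}\to N$ to a tm $(X,N)$ if there is a surjection $f\colon S\to X$ with $f(\psi(a)(s))=\varphi(a)(f(s))$ for all $a\in\Sigma$, $s\in S$. The asynchronous wreath product of $(\{S_i\},M)$ and $(\{Q_i\},N)$ is the atm $(\{S_i\times Q_i\},M\times\mathcal F(S,N))$, where $\mathcal F(S,N)$ is the set of all maps $S\to N$ and $(m,f)$ acts by $(s,q)\mapsto(m(s),f(s)(q))$. For a tm $T=(X,M)$ and $p\in\mathscr P$, $T[p]$ is the atm whose set of local states is $X$ at $p$ and a singleton at every other process, with $M$ acting on the $p$-component. $U_2$ is the tm on $\{1,2\}$ formed by the identity and the two constant maps. For a finite group $G$, $G[p]$ is $T[p]$ for the tm $T=(G,G)$, where $G$ acts on itself by right multiplication. A group $G$ divides a monoid $M$ if there is a surjective morphism onto $G$ from a submonoid of $M$. **Theorem.** Suppose that the communication graph of $\{\Sigma_i\}$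 is acyclic. Then $\{\Sigma_i\}$ has the asynchronous Krohn–Rhodes property: every morphism $\varphi\colon\mathrm{Tr}\to M$ to a finite tm $(X,M)$ is simulated by an asynchronous morphism to an atm which is an asynchronous wreath product of finitely many (at least one) atms, each of the form $U_2[p]$ or $G[p]$ with $p\in\mathscr P$ and $G$ a (non-trivial) simple group dividing $M$. -/

import Mathlib

universe u v w

namespace AsyncKR

/-! ### Transformation monoids -/

/-- The transformations of a set `X`. -/
def Transf (X : Type w) : Type w := X → X

/-- Transformations are multiplied from left to right: in `f * g`, first `f` is applied,
then `g`. -/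
instance (X : Type w) : Monoid (Transf X) where
  mul f g := fun x => g (f x)
  one := fun x => x
  mul_assoc _ _ _ := rfl
  one_mul _ := rfl
  mul_one _ := rfl

/-- The identity and the constant maps of a two-element set: together with the set
`Fin 2`, this is the transformation monoid `U₂`. -/
def U₂ : Submonoid (Transf (Fin 2)) where
  carrier := {f | f = 1 ∨ ∃ c : Fin 2, f = fun _ => c}
  one_mem' := Or.inl rfl
  mul_mem' := by
    rintro f g (rfl | ⟨c, rfl⟩) (rfl | ⟨d, rfl⟩)
    · exact Or.inl rfl
    · exact Or.inr ⟨d, rfl⟩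
    · exact Or.inr ⟨c, rfl⟩
    · exact Or.inr ⟨d, rfl⟩

/-- Right multiplication, as a morphism from `G` to the transformations of `G`. -/
def rightMul (G : Type w) [Monoid G] : G →* Transf G where
  toFun m := fun x => x * m
  map_one' := funext fun x => mul_one x
  map_mul' m n := funext fun x => (mul_assoc x m n).symm

/-- The monoid of the transformation monoid `(G, G)`: all right multiplications on `G`. -/
def regular (G : Type w) [Monoid G] : Submonoid (Transf G) := MonoidHom.mrange (rightMul G)

/-- `M` divides `N`: `M` is a quotient of a submonoid of `N`. -/
def Divides (M : Type v) (N : Type w) [Monoid M] [Monoid N] : Prop :=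
  ∃ (N' : Submonoid N) (π : N' →* M), Function.Surjective π

/-! ### Distributed alphabets and traces -/

/-- A distributed alphabet over the set of processes `P`: a family of non-empty finite sets
of letters, one for each process, whose union is the whole alphabet `A`. -/
structure DistributedAlphabet (P : Type u) (A : Type v) where
  letters : P → Finset A
  nonempty : ∀ i, (letters i).Nonempty
  cover : ∀ a, ∃ i, a ∈ letters i

namespace DistributedAlphabet

variable {P : Type u} {A : Type v} (D : DistributedAlphabet P A)

/-- The location of a letter: the set of processes that take part in it. -/
def loc (a : A) : Set P := {i | a ∈ D.letters i}

/-- Two letters are independent if they have no process in common. -/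
def Indep (a b : A) : Prop := Disjoint (D.loc a) (D.loc b)

/-- The commutation relations between independent letters. -/
def commRel (x y : FreeMonoid A) : Prop :=
  ∃ a b : A, D.Indep a b ∧
    x = FreeMonoid.of a * FreeMonoid.of b ∧ y = FreeMonoid.of b * FreeMonoid.of a

/-- The trace monoid: the quotient of the free monoid over the alphabet by the congruence
generated by `ab = ba` for all independent letters `a`, `b`. -/
abbrev TraceMonoid : Type v := PresentedMonoid D.commRel

/-- The trace with a single event, labelled `a`. -/
def letter (a : A) : D.TraceMonoid := PresentedMonoid.of D.commRel a

/-- The communication graph: two distinct processes are adjacent if they share a letter. -/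
def communicationGraph : SimpleGraph P where
  Adj i j := i ≠ j ∧ ∃ a, a ∈ D.letters i ∧ a ∈ D.letters j
  symm := ⟨fun _ _ h => ⟨h.1.symm, h.2.imp fun _ ha => ⟨ha.2, ha.1⟩⟩⟩
  loopless := ⟨fun _ h => h.1 rfl⟩

end DistributedAlphabet

/-! ### Asynchronous transformation monoids -/

/-- A transformation `g` of the product of the `S i` is a `Q`-map if it is the extension of
some transformation of the product of the `S i` over `i ∈ Q`. -/
def IsPMap {P : Type u} {S : P → Type} (Q : Set P) (g : Transf (∀ i, S i)) : Prop :=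
  ∃ f : (∀ i : Q, S i) → (∀ i : Q, S i),
    ∀ s, (∀ i : Q, g s i = f (fun j => s j) i) ∧ ∀ i, i ∉ Q → g s i = s i

/-- An asynchronous transformation monoid over the set of processes `P`. -/
structure Atm (P : Type u) where
  /-- the local states of each process -/
  S : P → Type
  finite : ∀ i, Finite (S i)
  nonempty : ∀ i, Nonempty (S i)
  /-- the monoid, acting on the global states -/
  M : Submonoid (Transf (∀ i, S i))

namespace Atm

variable {P : Type u}

/-- The local states of the localized atm `T[p]`, for a transformation monoid `T` on `X`:
`LocalState p X p` is a copy of `X`, and `LocalState p X i` is a singleton for `i ≠ p`. -/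
def LocalState (p : P) (X : Type) (i : P) : Type := i = p → X

/-- The extension of a transformation of `X`, taken as the set of local states of `p`,
to the global states. -/
def extend (p : P) (X : Type) : Transf X →* Transf (∀ i, LocalState p X i) where
  toFun f := fun s _ _ => f (s p rfl)
  map_one' := by
    funext s i h
    subst h
    rfl
  map_mul' _ _ := rfl

/-- The localized atm `T[p]`, where `T = (X, M)` is a finite transformation monoid. -/
def localized (p : P) (X : Type) [Finite X] [Nonempty X] (M : Submonoid (Transf X)) :
    Atm P where
  S := LocalState p X
  finite i := inferInstanceAs (Finite (i = p → X))
  nonempty i := inferInstanceAs (Nonempty (i = p → X))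
  M := M.map (extend p X)

/-- The asynchronous wreath product. The element `(m, f)` of `M × 𝓕(S, N)` acts on the
global states by `(s, q) ↦ (m s, f s q)`. -/
def wreath (T₁ T₂ : Atm P) : Atm P where
  S i := T₁.S i × T₂.S i
  finite i := by
    have := T₁.finite i
    have := T₂.finite i
    infer_instance
  nonempty i := by
    have := T₁.nonempty i
    have := T₂.nonempty i
    infer_instance
  M :=
    { carrier := {h | ∃ (m : T₁.M) (f : (∀ i, T₁.S i) → T₂.M),
        h = fun x i => (m.1 (fun j => (x j).1) i,
          (f fun j => (x j).1).1 (fun j => (x j).2) i)}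
      one_mem' := ⟨1, fun _ => 1, rfl⟩
      mul_mem' := by
        rintro _ _ ⟨m, f, rfl⟩ ⟨m', f', rfl⟩
        exact ⟨m * m', fun s => f s * f' (m.1 s), rfl⟩ }

/-- `IsWreathProductOf C T`: the atm `T` is an asynchronous wreath product of finitely many,
and at least one, atms from the class `C`. Since the asynchronous wreath product is
associative (up to the rebracketing of local states), bracketings are not restricted. -/
inductive IsWreathProductOf (C : Atm P → Prop) : Atm P → Prop
  | single (T : Atm P) : C T → IsWreathProductOf C T
  | wreath (T₁ T₂ : Atm P) :
      IsWreathProductOf C T₁ → IsWreathProductOf C T₂ → IsWreathProductOf C (wreath T₁ T₂)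

/-- `T` is of the form `U₂[p]`, or of the form `G[p]` for a simple group `G` dividing `M`.
(Simple groups are non-trivial.) -/
def IsKRFactor (M : Type w) [Monoid M] (T : Atm P) : Prop :=
  (∃ p : P, T = localized p (Fin 2) U₂) ∨
  ∃ (p : P) (G : Type) (_ : Group G) (_ : Finite G),
    IsSimpleGroup G ∧ Divides G M ∧ T = localized p G (regular G)

end Atm

/-! ### The asynchronous Krohn-Rhodes property -/

namespace DistributedAlphabet

variable {P : Type u} {A : Type v} (D : DistributedAlphabet P A)

/-- A morphism from the trace monoid to an atm is asynchronous if it maps every letter `a`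
to a `loc a`-map. -/
def IsAsynchronous (T : Atm P) (ψ : D.TraceMonoid →* T.M) : Prop :=
  ∀ a, IsPMap (D.loc a) (ψ (D.letter a)).1

/-- The morphism `ψ` to `(Y, N)` simulates the morphism `φ` to `(X, M)`. -/
def Simulates {X : Type w} {Y : Type u} {M : Submonoid (Transf X)} {N : Submonoid (Transf Y)}
    (ψ : D.TraceMonoid →* N) (φ : D.TraceMonoid →* M) : Prop :=
  ∃ f : Y → X, Function.Surjective f ∧
    ∀ (a : A) (y : Y), f ((ψ (D.letter a)).1 y) = (φ (D.letter a)).1 (f y)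

/-- The asynchronous Krohn-Rhodes property: every morphism from the trace monoid to a finite
transformation monoid `(X, M)` is simulated by an asynchronous morphism to an asynchronous
wreath product of atms `U₂[p]` and `G[p]`, where the `G` are simple groups dividing `M`. -/
def HasAsyncKRProperty : Prop :=
  ∀ (X : Type w) [Finite X] [Nonempty X] (M : Submonoid (Transf X))
    (φ : D.TraceMonoid →* M),
    ∃ T : Atm P, T.IsWreathProductOf (Atm.IsKRFactor M) ∧
      ∃ ψ : D.TraceMonoid →* T.M, D.IsAsynchronous T ψ ∧ D.Simulates ψ φ

end DistributedAlphabet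

end AsyncKR

namespace AsyncKR

/-! ### Divisibility -/

/-! Processes are eliminated one leaf of the communication graph at a time. Let `ℓ` be a leaf and
`K` the submonoid of `M` generated by the letters located at `ℓ` alone. Process `ℓ` stores the
product `k` in `K` of its local letters since its last communication; at a communication `a` it
hands `k` over and resets to `1`, so the other participants execute `k * a`. A global state then
represents `k` applied to the state represented by the others, which is sound because `k` commutes
with every letter avoiding `ℓ` (`Realizable.of_eliminate`). The modified letters still commute when
their locations are disjoint: two communications of `ℓ` both involve its only neighbour
(`eliminate_commute`).

What process `ℓ` does is sequential: right multiplications and resets on `K`. These are decomposed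
at a single process by the Krohn-Rhodes theorem, proved with local divisors
(`locallyRealizable_mulResets`).

No morphism is carried through the induction, only one map per letter: maps acting on disjoint sets
of processes commute, so the letter maps extend to traces by themselves. -/

theorem Divides.trans {L : Type*} {M : Type*} {N : Type*} [Monoid L] [Monoid M] [Monoid N]
    (h₁ : Divides L M) (h₂ : Divides M N) : Divides L N := by
  obtain ⟨M', π, hπ⟩ := h₁
  obtain ⟨N', ρ, hρ⟩ := h₂
  let K : Submonoid N' := M'.comap ρ
  let e : K ≃* K.map N'.subtype :=
    K.equivMapOfInjective N'.subtype Subtype.val_injective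
  let r : K →* M' :=
    { toFun := fun y => ⟨ρ y.1, y.2⟩
      map_one' := Subtype.ext (map_one ρ)
      map_mul' := fun x y => Subtype.ext (map_mul ρ x.1 y.1) }
  refine ⟨K.map N'.subtype, (π.comp r).comp e.symm.toMonoidHom, fun g => ?_⟩
  obtain ⟨m, rfl⟩ := hπ g
  obtain ⟨y, hy⟩ := hρ m.1
  have hyK : y ∈ K := by
    change ρ y ∈ M'
    rw [hy]
    exact m.2
  refine ⟨e ⟨y, hyK⟩, ?_⟩
  have : r ⟨y, hyK⟩ = m := Subtype.ext hy
  simp [this]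

theorem Divides.of_surjective {M : Type*} {N : Type*} [Monoid M] [Monoid N] (f : N →* M)
    (hf : Function.Surjective f) : Divides M N :=
  ⟨⊤, f.comp (⊤ : Submonoid N).subtype, fun m => by
    obtain ⟨n, rfl⟩ := hf m
    exact ⟨⟨n, trivial⟩, rfl⟩⟩

theorem Divides.of_submonoid {N : Type*} [Monoid N] (M : Submonoid N) : Divides M N :=
  ⟨M, MonoidHom.id M, Function.surjective_id⟩

/-! ### Families of transformations realized at a single process -/

section Local

variable {P : Type u}

/-- The identity and the constant maps. -/
def resets (X : Type*) : Set (Transf X) := {m | m = 1 ∨ ∃ c, m = fun _ => c}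

/-- The right multiplications by the elements of `B`, and the constant maps. -/
def mulResets {M : Type*} [Monoid M] (B : Set M) : Set (Transf M) :=
  {m | (∃ b ∈ B, m = rightMul M b) ∨ ∃ c, m = fun _ => c}

/-- The triangular transformations of `X × Y` with components in `Φ` and `Ψ`. -/
def wreathSet {X Y : Type*} (Φ : Set (Transf X)) (Ψ : Set (Transf Y)) : Set (Transf (X × Y)) :=
  {m | ∃ n ∈ Φ, ∃ h : X → Transf Y, (∀ x, h x ∈ Ψ) ∧ m = fun z => (n z.1, h z.1 z.2)}

/-- All the maps in `Φ` are simulated by elements of a wreath product of atms from `C`, all of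
them localized at the process `p`. -/
def LocallyRealizable (C : Atm P → Prop) (p : P) {X : Type*} (Φ : Set (Transf X)) : Prop :=
  ∃ T : Atm P, T.IsWreathProductOf C ∧ (∀ i, i ≠ p → Subsingleton (T.S i)) ∧
    ∃ f : (∀ i, T.S i) → X, Function.Surjective f ∧
      ∀ m ∈ Φ, ∃ t ∈ T.M, ∀ s, f (t s) = m (f s)

variable {C : Atm P → Prop} {p : P}

theorem LocallyRealizable.of_surjective {X Y : Type*} {Φ : Set (Transf X)} {Ψ : Set (Transf Y)}
    (h : LocallyRealizable C p Φ) (f : X → Y) (hf : Function.Surjective f)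
    (hΨ : ∀ m ∈ Ψ, ∃ n ∈ Φ, ∀ x, f (n x) = m (f x)) : LocallyRealizable C p Ψ := by
  obtain ⟨T, hT, hs, g, hg, H⟩ := h
  refine ⟨T, hT, hs, f ∘ g, hf.comp hg, fun m hm => ?_⟩
  obtain ⟨n, hn, hnm⟩ := hΨ m hm
  obtain ⟨t, ht, htn⟩ := H n hn
  exact ⟨t, ht, fun s => by simp [htn, hnm]⟩

theorem LocallyRealizable.wreath {X Y : Type*} {Φ : Set (Transf X)} {Ψ : Set (Transf Y)}
    (h₁ : LocallyRealizable C p Φ) (h₂ : LocallyRealizable C p Ψ) :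
    LocallyRealizable C p (wreathSet Φ Ψ) := by
  obtain ⟨T₁, hT₁, hs₁, f₁, hf₁, H₁⟩ := h₁
  obtain ⟨T₂, hT₂, hs₂, f₂, hf₂, H₂⟩ := h₂
  refine ⟨Atm.wreath T₁ T₂, .wreath _ _ hT₁ hT₂, fun i hi => ?_,
    fun s => (f₁ fun i => (s i).1, f₂ fun i => (s i).2), ?_, ?_⟩
  · have := hs₁ i hi
    have := hs₂ i hi
    exact inferInstanceAs (Subsingleton (T₁.S i × T₂.S i))
  · rintro ⟨x, y⟩
    obtain ⟨a, rfl⟩ := hf₁ x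
    obtain ⟨b, rfl⟩ := hf₂ y
    exact ⟨fun i => (a i, b i), rfl⟩
  · rintro _ ⟨n, hn, k, hk, rfl⟩
    obtain ⟨t, ht, htn⟩ := H₁ n hn
    choose r hr hrn using fun x => H₂ (k x) (hk x)
    refine ⟨_, ⟨⟨t, ht⟩, fun s => ⟨r (f₁ s), hr _⟩, rfl⟩, fun s => ?_⟩
    exact Prod.ext (htn _) (hrn _ _)

theorem LocallyRealizable.localized {X : Type} [Finite X] [Nonempty X] (M : Submonoid (Transf X))
    (h : C (Atm.localized p X M)) : LocallyRealizable C p (M : Set (Transf X)) := by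
  refine ⟨_, .single _ h, fun i hi => ?_, fun s => s p rfl, fun x => ⟨fun _ _ => x, rfl⟩,
    fun m hm => ⟨Atm.extend p X m, ⟨m, hm, rfl⟩, fun _ => rfl⟩⟩
  exact ⟨fun a b => funext fun e => (hi e).elim⟩

/-- A further `U₂` factor adds one point: all pairs with first coordinate `0` represent the new
point, and a reset of the pair can be made coordinatewise. -/
theorem locallyRealizable_resets_fin (hC : C (Atm.localized p (Fin 2) U₂)) (k : ℕ) :
    LocallyRealizable C p (resets (Fin (k + 1))) := by
  have h2 : LocallyRealizable C p (resets (Fin 2)) := LocallyRealizable.localized U₂ hC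
  induction k with
  | zero =>
    refine h2.of_surjective (fun _ => 0) (fun x => ⟨0, (Fin.fin_one_eq_zero x).symm⟩) fun m _ =>
      ⟨1, Or.inl rfl, fun x => (Fin.fin_one_eq_zero _).symm⟩
  | succ k ih =>
    let f : Fin 2 × Fin (k + 1) → Fin (k + 1 + 1) := fun z => if z.1 = 0 then 0 else z.2.succ
    have hf : Function.Surjective f := fun x => by
      rcases Fin.eq_zero_or_eq_succ x with rfl | ⟨y, rfl⟩
      · exact ⟨(0, 0), rfl⟩
      · exact ⟨(1, y), rfl⟩
    refine (h2.wreath ih).of_surjective f hf ?_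
    rintro _ (rfl | ⟨c, rfl⟩)
    · exact ⟨_, ⟨1, Or.inl rfl, fun _ => 1, fun _ => Or.inl rfl, rfl⟩, fun _ => rfl⟩
    · obtain ⟨z, rfl⟩ := hf c
      exact ⟨_, ⟨fun _ => z.1, Or.inr ⟨_, rfl⟩, fun _ _ => z.2, fun _ => Or.inr ⟨_, rfl⟩, rfl⟩,
        fun _ => rfl⟩

theorem locallyRealizable_resets (hC : C (Atm.localized p (Fin 2) U₂)) (X : Type*) [Finite X]
    [Nonempty X] : LocallyRealizable C p (resets X) := by
  obtain ⟨n, ⟨e⟩⟩ := Finite.exists_equiv_fin X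
  obtain ⟨k, rfl⟩ : ∃ k, n = k + 1 :=
    Nat.exists_eq_succ_of_ne_zero fun h => by
      subst h
      exact (e (Classical.arbitrary X)).elim0
  refine (locallyRealizable_resets_fin hC k).of_surjective e.symm e.symm.surjective ?_
  rintro _ (rfl | ⟨c, rfl⟩)
  · exact ⟨1, Or.inl rfl, fun _ => rfl⟩
  · exact ⟨fun _ => e c, Or.inr ⟨_, rfl⟩, fun _ => e.symm_apply_apply c⟩

/-! ### Groups -/

/-- A proper nontrivial normal subgroup `N` splits `G` by writing each element as `x * σ q`, with
`x` in `N` and `σ` a section of the quotient map. Multiplication by `g` changes `x` by a factor of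
`N` that depends on `q`, which is a wreath product action. -/
theorem locallyRealizable_regular (hC : C (Atm.localized p (Fin 2) U₂)) (n : ℕ) :
    ∀ (G : Type w) [Group G] [Finite G], Nat.card G ≤ n →
      (∀ (H : Type w) [Group H] [Finite H], IsSimpleGroup H → Divides H G →
        LocallyRealizable C p (regular H : Set (Transf H))) →
      LocallyRealizable C p (regular G : Set (Transf G)) := by
  induction n with
  | zero => exact fun G _ _ hn => absurd hn (by have := Nat.card_pos (α := G); omega)
  | succ n ih =>
    intro G _ _ hn H
    rcases subsingleton_or_nontrivial G with hG | hG
    -- A wreath product needs at least one factor, so the trivial group is covered by resets.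
    · exact (locallyRealizable_resets hC G).of_surjective id Function.surjective_id fun m _ =>
        ⟨1, Or.inl rfl, fun _ => Subsingleton.elim _ _⟩
    by_cases hs : IsSimpleGroup G
    · exact H G hs (Divides.of_surjective (MonoidHom.id G) Function.surjective_id)
    obtain ⟨N, hN, hbot, htop⟩ : ∃ N : Subgroup G, N.Normal ∧ N ≠ ⊥ ∧ N ≠ ⊤ := by
      by_contra! h
      exact hs ⟨fun N hN => or_iff_not_imp_left.2 (h N hN)⟩
    have hcard : Nat.card (G ⧸ N) * Nat.card N = Nat.card G :=
      (Subgroup.card_eq_card_quotient_mul_card_subgroup N).symm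
    have hN1 : 1 < Nat.card N := Subgroup.one_lt_card_iff_ne_bot N |>.2 hbot
    have hQ1 : 1 < Nat.card (G ⧸ N) := by
      have h1 : N.index ≠ 1 := fun h => htop (Subgroup.index_eq_one.1 h)
      have h0 : Nat.card (G ⧸ N) ≠ 0 := Nat.card_pos.ne'
      rw [Subgroup.index] at h1
      omega
    have hNn : Nat.card N ≤ n := by nlinarith
    have hQn : Nat.card (G ⧸ N) ≤ n := by nlinarith
    have hNr := ih N hNn fun K _ _ hK hd =>
      H K hK (hd.trans ⟨N.toSubmonoid, MonoidHom.id _, Function.surjective_id⟩)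
    have hQr := ih (G ⧸ N) hQn fun K _ _ hK hd =>
      H K hK (hd.trans (Divides.of_surjective (QuotientGroup.mk' N)
        (QuotientGroup.mk'_surjective N)))
    let σ : G ⧸ N → G := Quotient.out
    have hσ : ∀ q, (σ q : G ⧸ N) = q := fun q => Quotient.out_eq q
    have hmem : ∀ (q : G ⧸ N) (g : G), σ q * g * (σ (q * (g : G ⧸ N)))⁻¹ ∈ N := fun q g => by
      rw [← QuotientGroup.eq_one_iff]
      simp [hσ]
    refine (hQr.wreath hNr).of_surjective (fun z => (z.2 : G) * σ z.1) (fun g => ?_) ?_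
    · refine ⟨((g : G ⧸ N), ⟨g * (σ (g : G ⧸ N))⁻¹, ?_⟩), by simp⟩
      rw [← QuotientGroup.eq_one_iff]
      simp [hσ]
    · rintro _ ⟨g, rfl⟩
      refine ⟨_, ⟨rightMul _ (g : G ⧸ N), ⟨_, rfl⟩, fun q => rightMul N ⟨_, hmem q g⟩,
        fun q => ⟨_, rfl⟩, rfl⟩, ?_⟩
      rintro ⟨q, x⟩
      change (x : G) * (σ q * g * (σ (q * (g : G ⧸ N)))⁻¹) * σ (q * (g : G ⧸ N)) = x * σ q * g
      simp [mul_assoc]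

theorem locallyRealizable_mulResets_group (hC : C (Atm.localized p (Fin 2) U₂))
    (G : Type w) [Group G] [Finite G]
    (h : LocallyRealizable C p (regular G : Set (Transf G))) (B : Set G) :
    LocallyRealizable C p (mulResets B) := by
  refine (h.wreath (locallyRealizable_resets hC G)).of_surjective (fun z => z.2 * z.1)
    (fun g => ⟨(1, g), mul_one g⟩) ?_
  rintro _ (⟨g, -, rfl⟩ | ⟨c, rfl⟩)
  · exact ⟨_, ⟨rightMul G g, ⟨g, rfl⟩, fun _ => 1, fun _ => Or.inl rfl, rfl⟩,
      fun z => (mul_assoc z.2 z.1 g).symm⟩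
  -- The group component `z` cannot be reset; the other component compensates for it by storing `c *
  -- z⁻¹`.
  · exact ⟨_, ⟨1, ⟨1, map_one _⟩, fun z _ => c * z⁻¹, fun _ => Or.inr ⟨_, rfl⟩, rfl⟩,
      fun z => inv_mul_cancel_right c z.1⟩

/-! ### The local divisor of a monoid -/

section LocalDivisor

variable {M : Type w} [Monoid M]

/-- The elements `y` such that `c * y` is a left multiple of `c`. -/
def rightStabilizer (c : M) : Submonoid M where
  carrier := {y | ∃ x, c * y = x * c}
  one_mem' := ⟨1, by simp⟩
  mul_mem' := by
    rintro a b ⟨x, hx⟩ ⟨y, hy⟩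
    exact ⟨x * y, by rw [← mul_assoc, hx, mul_assoc, hy, mul_assoc]⟩

/-- The congruence on `rightStabilizer c` identifying `y` and `z` when `c * y = c * z`. -/
def localDivisorCon (c : M) : Con (rightStabilizer c) where
  r y z := c * y = c * z
  iseqv := ⟨fun _ => rfl, fun h => h.symm, fun h h' => h.trans h'⟩
  mul' := by
    rintro ⟨y, a, ha⟩ ⟨y', ha'⟩ ⟨z, hz⟩ ⟨z', hz'⟩ h h'
    change c * y = c * y' at h
    change c * z = c * z' at h'
    change c * (y * z) = c * (y' * z')
    rw [← mul_assoc, ← mul_assoc, ← h, ha, mul_assoc, h', mul_assoc]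

/-- The local divisor of `M` at `c`. -/
abbrev LocalDivisor (c : M) : Type w := (localDivisorCon c).Quotient

/-- The class of `y` in the local divisor at `c` is sent to `c * y`. -/
def LocalDivisor.val {c : M} (x : LocalDivisor c) : M :=
  Con.liftOn x (fun y => c * y) fun _ _ h => h

theorem LocalDivisor.val_injective (c : M) :
    Function.Injective (LocalDivisor.val : LocalDivisor c → M) := by
  intro x y
  induction x using Con.induction_on with | _ x
  induction y using Con.induction_on with | _ y
  exact fun h => (Con.eq _).2 h

theorem LocalDivisor.val_one (c : M) : (1 : LocalDivisor c).val = c := mul_one c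

theorem LocalDivisor.val_mul_mk {c : M} (x : LocalDivisor c) (y : rightStabilizer c) :
    (x * (y : LocalDivisor c)).val = x.val * y := by
  induction x using Con.induction_on with | _ x
  exact (mul_assoc c (x : M) (y : M)).symm

theorem LocalDivisor.divides (c : M) : Divides (LocalDivisor c) M :=
  ⟨rightStabilizer c, (localDivisorCon c).mk', Con.mk'_surjective⟩

/-- The local divisor embeds in `M` as a set and misses `1`, since in a finite monoid a one-sided
inverse of `c` would make it a unit. -/
theorem LocalDivisor.card_lt [Finite M] {c : M} (hc : ¬IsUnit c) :
    Nat.card (LocalDivisor c) < Nat.card M := by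
  have : Finite (LocalDivisor c) := Finite.of_injective _ (LocalDivisor.val_injective c)
  have := Fintype.ofFinite M
  have := Fintype.ofFinite (LocalDivisor c)
  rw [Nat.card_eq_fintype_card, Nat.card_eq_fintype_card]
  refine Fintype.card_lt_of_injective_of_notMem (LocalDivisor.val : LocalDivisor c → M)
    (LocalDivisor.val_injective c) (b := 1) ?_
  rintro ⟨x, hx⟩
  induction x using Con.induction_on with | _ x
  exact hc (IsUnit.of_mul_eq_one _ hx)

theorem mul_mem_rightStabilizer (c m : M) : m * c ∈ rightStabilizer c :=
  ⟨c * m, (mul_assoc c m c).symm⟩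

end LocalDivisor

/-! ### The Krohn-Rhodes theorem -/

/-- The state is `(n, flag, u, n₀, x)`, with value `u * n` or `u * n₀ * x * n`, according to
whether `c` has not or has been read since the last reset to `u`. -/
def localDivisorValue {M : Type w} [Monoid M] (N : Submonoid M) (c : M) :
    N × Bool × M × N × LocalDivisor c → M
  | (n, false, u, _, _) => u * n
  | (n, true, u, n₀, x) => u * n₀ * x.val * n

/-- Since the last reset, the word read factors as `n₀ c n₁ c ⋯ c n` with blocks in `N`. The middle
part, from the first to the last `c`, is a product of classes of `nᵢ * c` in the local divisor; only
the current block is accumulated in `N`. -/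
theorem LocallyRealizable.of_localDivisor (hC : C (Atm.localized p (Fin 2) U₂)) {M : Type w}
    [Monoid M] [Finite M] (N : Submonoid M) (c : M) (A : Set M) (hA : A ⊆ N)
    (hN : LocallyRealizable C p (mulResets ((↑) ⁻¹' A : Set N)))
    (hL : LocallyRealizable C p (mulResets (Set.univ : Set (LocalDivisor c)))) :
    LocallyRealizable C p (mulResets (insert c A)) := by
  have hBool := locallyRealizable_resets hC Bool
  have hM := locallyRealizable_resets hC M
  have hN₀ := locallyRealizable_resets hC N
  have id_mem : (1 : Transf (LocalDivisor c)) ∈ mulResets Set.univ :=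
    Or.inl ⟨1, trivial, (map_one _).symm⟩
  refine (hN.wreath (hBool.wreath (hM.wreath (hN₀.wreath hL)))).of_surjective
    (localDivisorValue N c) (fun m => ⟨(1, false, m, 1, 1), mul_one m⟩) ?_
  rintro _ (⟨b, rfl | hb, rfl⟩ | ⟨m, rfl⟩)
  -- Reading `c`: the block `n` is reset, while the later components still see its old value. At the
  -- first `c` it is saved in `n₀` and `x` starts at `1`, whose value is `c`; afterwards `x` is
  -- multiplied by the class of `n * c`.
  · refine ⟨_, ⟨fun _ => 1, Or.inr ⟨1, rfl⟩, fun n => _, fun n => ⟨fun _ => true, Or.inr ⟨_, rfl⟩,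
      fun flag => _, fun flag => ⟨1, Or.inl rfl, fun _ => _, fun _ =>
        ⟨cond flag 1 fun _ => n, ?_, fun _ => cond flag
          (rightMul _ ((⟨n * b, mul_mem_rightStabilizer b n⟩ : rightStabilizer b) :
            LocalDivisor b)) fun _ => 1, fun _ => ?_, rfl⟩, rfl⟩, rfl⟩, rfl⟩, ?_⟩
    · cases flag
      · exact Or.inr ⟨n, rfl⟩
      · exact Or.inl rfl
    · cases flag
      · exact Or.inr ⟨1, rfl⟩
      · exact Or.inl ⟨_, trivial, rfl⟩
    · rintro ⟨n, _ | _, u, n₀, x⟩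
      · change u * n * (1 : LocalDivisor b).val * ((1 : N) : M) = u * n * b
        rw [LocalDivisor.val_one, OneMemClass.coe_one, mul_one]
      · change u * n₀ * (x * ((⟨n * b, mul_mem_rightStabilizer b n⟩ : rightStabilizer b) :
          LocalDivisor b)).val * ((1 : N) : M) = u * n₀ * x.val * n * b
        rw [LocalDivisor.val_mul_mk, OneMemClass.coe_one, mul_one]
        simp only [mul_assoc]
  · refine ⟨_, ⟨rightMul N ⟨b, hA hb⟩, Or.inl ⟨_, hb, rfl⟩, fun _ => 1, fun _ => ⟨1, Or.inl rfl,
      fun _ => 1, fun _ => ⟨1, Or.inl rfl, fun _ => 1, fun _ => ⟨1, Or.inl rfl,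
        fun _ => 1, fun _ => id_mem, rfl⟩, rfl⟩, rfl⟩, rfl⟩, ?_⟩
    rintro ⟨n, _ | _, u, n₀, x⟩
    · exact (mul_assoc u (n : M) b).symm
    · exact (mul_assoc _ (n : M) b).symm
  · refine ⟨_, ⟨fun _ => 1, Or.inr ⟨1, rfl⟩, fun _ => _, fun _ => ⟨fun _ => false, Or.inr ⟨_, rfl⟩,
      fun _ => _, fun _ => ⟨fun _ => m, Or.inr ⟨_, rfl⟩, fun _ => 1, fun _ => ⟨1, Or.inl rfl,
        fun _ => 1, fun _ => id_mem, rfl⟩, rfl⟩, rfl⟩, rfl⟩, fun _ => mul_one m⟩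

/-- Induction on the size of `M`, then on the number of generators. If all generators are units, `M`
is a group. Otherwise a non-unit `c` is split off: the remaining generators are fewer, and the local
divisor at `c` is smaller than `M`. -/
theorem locallyRealizable_mulResets (hC : C (Atm.localized p (Fin 2) U₂)) (n k : ℕ) :
    ∀ (M : Type w) [Monoid M] [Finite M] (B : Set M), Nat.card M ≤ n → B.ncard ≤ k →
      Submonoid.closure B = ⊤ →
      (∀ (H : Type w) [Group H] [Finite H], IsSimpleGroup H → Divides H M →
        LocallyRealizable C p (regular H : Set (Transf H))) →
      LocallyRealizable C p (mulResets B) := by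
  induction n generalizing k with
  | zero => exact fun M _ _ _ hn => absurd hn (by have := Nat.card_pos (α := M); omega)
  | succ n ihn =>
    induction k with
    | zero =>
      intro M _ _ B _ hk hB H
      have hBe : B = ∅ := (Set.ncard_eq_zero).1 (Nat.le_zero.1 hk)
      subst hBe
      refine (locallyRealizable_resets hC M).of_surjective id Function.surjective_id ?_
      rintro _ (⟨b, hb, -⟩ | ⟨c, rfl⟩)
      · exact hb.elim
      · exact ⟨_, Or.inr ⟨c, rfl⟩, fun _ => rfl⟩
    | succ k ihk =>
      intro M _ _ B hn hk hB H
      by_cases hu : ∀ b ∈ B, IsUnit b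
      · have hunit : ∀ a : M, IsUnit a := fun a => by
          have : Submonoid.closure B ≤ IsUnit.submonoid M := Submonoid.closure_le.2 hu
          rw [hB] at this
          exact this trivial
        let := groupOfIsUnit hunit
        exact locallyRealizable_mulResets_group hC M (locallyRealizable_regular hC _ M le_rfl H) B
      · push Not at hu
        obtain ⟨c, hcB, hc⟩ := hu
        have hins : insert c (B \ {c}) = B := by simp [Set.insert_eq_of_mem hcB]
        rw [← hins]
        have : Finite (LocalDivisor c) := Finite.of_injective _ (LocalDivisor.val_injective c)
        refine LocallyRealizable.of_localDivisor hC (Submonoid.closure (B \ {c})) c _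
          Submonoid.subset_closure ?_ ?_
        · refine ihk _ _ ((Finite.card_subtype_le _).trans hn) ?_
            Submonoid.closure_closure_coe_preimage
            fun K _ _ hK hd => H K hK (hd.trans (Divides.of_submonoid _))
          have h1 : (B \ {c}).ncard < B.ncard := Set.ncard_sdiff_singleton_lt_of_mem hcB
          have h2 : ((↑) ⁻¹' (B \ {c}) : Set (Submonoid.closure (B \ {c}))).ncard ≤
              (B \ {c}).ncard :=
            Set.ncard_le_ncard_of_injOn Subtype.val (fun x hx => hx)
              Subtype.val_injective.injOn (Set.toFinite _)
          omega
        · exact ihn _ _ _ (Nat.lt_succ_iff.1 ((LocalDivisor.card_lt hc).trans_le hn)) le_rfl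
            (by simp)
            fun K _ _ hK hd => H K hK (hd.trans (LocalDivisor.divides c))

end Local

/-! ### Maps of a product that act on a set of processes -/

section PMap

variable {P : Type u}

theorem isPMap_iff {S : P → Type} [∀ i, Nonempty (S i)] {Q : Set P} {g : Transf (∀ i, S i)} :
    IsPMap Q g ↔ (∀ s, ∀ i ∉ Q, g s i = s i) ∧
      ∀ s s', (∀ j ∈ Q, s j = s' j) → ∀ i ∈ Q, g s i = g s' i := by
  classical
  constructor
  · rintro ⟨f, hf⟩
    refine ⟨fun s => (hf s).2, fun s s' h i hi => ?_⟩
    have hs : (fun j : Q => s j) = fun j : Q => s' j := funext fun j => h j j.2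
    rw [(hf s).1 ⟨i, hi⟩, (hf s').1 ⟨i, hi⟩, hs]
  · rintro ⟨h₁, h₂⟩
    let ext : (∀ i : Q, S i) → ∀ i, S i := fun s i =>
      if h : i ∈ Q then s ⟨i, h⟩ else Classical.arbitrary _
    refine ⟨fun s i => g (ext s) i, fun s => ⟨fun i => h₂ _ _ (fun j hj => ?_) i i.2, h₁ s⟩⟩
    simp [ext, hj]

theorem IsPMap.mul_comm {S : P → Type} [∀ i, Nonempty (S i)] {Q R : Set P}
    {g h : Transf (∀ i, S i)} (hg : IsPMap Q g) (hh : IsPMap R h) (hQR : Disjoint Q R) :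
    g * h = h * g := by
  rw [isPMap_iff] at hg hh
  funext s i
  change h (g s) i = g (h s) i
  by_cases hi : i ∈ Q
  · have hR : ∀ j ∈ Q, j ∉ R := fun j hj hj' => Set.disjoint_left.1 hQR hj hj'
    rw [hh.1 _ i (hR i hi)]
    exact hg.2 _ _ (fun j hj => (hh.1 s j (hR j hj)).symm) i hi
  · rw [hg.1 _ i hi]
    by_cases hi' : i ∈ R
    · exact hh.2 _ _ (fun j hj => hg.1 s j fun hj' => Set.disjoint_left.1 hQR hj' hj) i hi'
    · rw [hh.1 _ i hi', hh.1 _ i hi', hg.1 _ i hi]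

/-- The choice of the second action reads the first factor, so it too must depend only on the
processes in `Q`. -/
theorem isPMap_wreath {T₁ T₂ : Atm P} {Q : Set P} {t : Transf (∀ i, T₁.S i)}
    {r : (∀ i, T₁.S i) → Transf (∀ i, T₂.S i)} {R : Set P} (hRQ : R ⊆ Q) (ht : IsPMap Q t)
    (hr : ∀ s, IsPMap R (r s)) (hrs : ∀ s s', (∀ i ∈ Q, s i = s' i) → r s = r s') :
    IsPMap (S := (Atm.wreath T₁ T₂).S) Q fun x i =>
      (t (fun j => (x j).1) i, r (fun j => (x j).1) (fun j => (x j).2) i) := by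
  have := T₁.nonempty
  have := T₂.nonempty
  have := (Atm.wreath T₁ T₂).nonempty
  simp only [isPMap_iff] at ht hr
  refine isPMap_iff.2 ⟨fun s i hi => Prod.ext (ht.1 _ i hi) ((hr _).1 _ i fun h => hi (hRQ h)),
    fun s s' h i hi => Prod.ext ?_ ?_⟩
  · exact ht.2 _ _ (fun j hj => congrArg Prod.fst (h j hj)) i hi
  · have h₂ : ∀ j ∈ Q, (s j).2 = (s' j).2 := fun j hj => congrArg Prod.snd (h j hj)
    change r (fun j => (s j).1) (fun j => (s j).2) i = r (fun j => (s' j).1) (fun j => (s' j).2) i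
    rw [hrs _ (fun j => (s' j).1) fun j hj => congrArg Prod.fst (h j hj)]
    by_cases hiR : i ∈ R
    · exact (hr _).2 _ _ (fun j hj => h₂ j (hRQ hj)) i hiR
    · rw [(hr _).1 _ i hiR, (hr _).1 _ i hiR]
      exact h₂ i hi

theorem isPMap_one {S : P → Type} [∀ i, Nonempty (S i)] (Q : Set P) :
    IsPMap Q (1 : Transf (∀ i, S i)) :=
  isPMap_iff.2 ⟨fun _ _ _ => rfl, fun _ _ h => h⟩

theorem isPMap_of_subsingleton {S : P → Type} [∀ i, Nonempty (S i)] {p : P} {Q : Set P}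
    (hp : p ∈ Q) (hS : ∀ i, i ≠ p → Subsingleton (S i)) (g : Transf (∀ i, S i)) :
    IsPMap Q g := by
  refine isPMap_iff.2 ⟨fun s i hi => ?_, fun s s' h i _ => ?_⟩
  · have := hS i (by rintro rfl; exact hi hp)
    exact Subsingleton.elim _ _
  · have : s = s' := funext fun j => by
      by_cases hj : j = p
      · exact h j (hj ▸ hp)
      · have := hS j hj
        exact Subsingleton.elim _ _
    rw [this]

end PMap

/-! ### Acyclic graphs -/

theorem exists_leaf {V : Type*} [Finite V] [Nonempty V] (G : SimpleGraph V) (hG : G.IsAcyclic) :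
    ∃ v, ∀ i j, G.Adj v i → G.Adj v j → i = j := by
  classical
  obtain ⟨v₀⟩ := ‹Nonempty V›
  let c := G.connectedComponentMk v₀
  have := Fintype.ofFinite c
  have hadj : ∀ (v : c) (i : V), G.Adj v i → i ∈ c.supp := fun v i h =>
    (c.mem_supp_congr_adj h).1 v.2
  rcases subsingleton_or_nontrivial c with hc | hc
  · refine ⟨v₀, fun i j hi _ => ?_⟩
    have := Subsingleton.elim (α := c) ⟨v₀, rfl⟩ ⟨i, hadj ⟨v₀, rfl⟩ i hi⟩
    exact absurd (congrArg Subtype.val this) hi.ne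
  · obtain ⟨v, hv⟩ := (hG.isTree_connectedComponent c).exists_vert_degree_one_of_nontrivial
    obtain ⟨w, -, hw⟩ := SimpleGraph.degree_eq_one_iff_existsUnique_adj.1 hv
    refine ⟨v, fun i j hi hj => ?_⟩
    have h₁ := hw ⟨i, hadj v i hi⟩ hi
    have h₂ := hw ⟨j, hadj v j hj⟩ hj
    exact congrArg Subtype.val (h₁.trans h₂.symm)

theorem exists_leaf_finset {V : Type*} (G : SimpleGraph V) (hG : G.IsAcyclic) {Q : Finset V}
    (hQ : Q.Nonempty) :
    ∃ v ∈ Q, ∀ i ∈ Q, ∀ j ∈ Q, G.Adj v i → G.Adj v j → i = j := by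
  have : Nonempty (Q : Set V) := hQ.to_subtype
  obtain ⟨v, hv⟩ := exists_leaf _ (hG.induce (Q : Set V))
  exact ⟨v, v.2, fun i hi j hj h h' => congrArg Subtype.val (hv ⟨i, hi⟩ ⟨j, hj⟩ h h')⟩

/-! ### Elimination of leaf processes -/

section Realizable

variable {P : Type u} {X : Type w} {M : Submonoid (Transf X)}

/-- Every `(L, m)` in `Φ` is simulated by an `L`-map in one and the same wreath product of atms
from `C`. -/
def Realizable (C : Atm P → Prop) (Φ : Set (Set P × M)) : Prop :=
  ∃ T : Atm P, T.IsWreathProductOf C ∧ ∃ f : (∀ i, T.S i) → X, Function.Surjective f ∧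
    ∀ a ∈ Φ, ∃ t ∈ T.M, IsPMap a.1 t ∧ ∀ s, f (t s) = a.2.1 (f s)

/-- The submonoid generated by the elements of `Φ` located at `ℓ` only. -/
def localSubmonoid (Φ : Set (Set P × M)) (ℓ : P) : Submonoid M :=
  Submonoid.closure {m | ({ℓ}, m) ∈ Φ}

/-- The family obtained from `Φ` when the process `ℓ` is removed, and sends to its partners the
local computation `k` that it has performed since the previous communication. -/
def eliminate (Φ : Set (Set P × M)) (ℓ : P) : Set (Set P × M) :=
  {b | b.1.Nonempty ∧ ∃ a ∈ Φ, b.1 = a.1 \ {ℓ} ∧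
    ((ℓ ∉ a.1 ∧ b.2 = a.2) ∨ (ℓ ∈ a.1 ∧ ∃ k ∈ localSubmonoid Φ ℓ, b.2 = k * a.2))}

theorem localSubmonoid_commute {Φ : Set (Set P × M)} {ℓ : P}
    (hΦ : ∀ a ∈ Φ, ∀ b ∈ Φ, Disjoint a.1 b.1 → Commute a.2 b.2) {k : M}
    (hk : k ∈ localSubmonoid Φ ℓ) {a : Set P × M} (ha : a ∈ Φ) (hℓ : ℓ ∉ a.1) :
    Commute k a.2 := by
  have : localSubmonoid Φ ℓ ≤ Submonoid.centralizer {a.2} := Submonoid.closure_le.2 fun m hm => by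
    rw [SetLike.mem_coe, Submonoid.mem_centralizer_iff]
    rintro _ rfl
    exact (hΦ _ hm _ ha (Set.disjoint_singleton_left.2 hℓ)).symm
  exact (Submonoid.mem_centralizer_iff.1 (this hk) _ rfl).symm

theorem Realizable.of_eliminate {C : Atm P → Prop} {Φ : Set (Set P × M)} {ℓ : P}
    (hne : ∀ a ∈ Φ, a.1.Nonempty)
    (hΦ : ∀ a ∈ Φ, ∀ b ∈ Φ, Disjoint a.1 b.1 → Commute a.2 b.2)
    (hloc : LocallyRealizable C ℓ (mulResets (Set.univ : Set (localSubmonoid Φ ℓ))))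
    (h : Realizable C (eliminate Φ ℓ)) : Realizable C Φ := by
  obtain ⟨T₁, hT₁, hs, g, hg, H₁⟩ := hloc
  obtain ⟨T₂, hT₂, f, hf, H₂⟩ := h
  have := T₁.nonempty
  have := T₂.nonempty
  have hgℓ : ∀ s s' : ∀ i, T₁.S i, s ℓ = s' ℓ → s = s' := fun s s' h => funext fun i => by
    by_cases hi : i = ℓ
    · subst hi
      exact h
    · have := hs i hi
      exact Subsingleton.elim _ _
  -- The pending element of `ℓ` acts last, as if its local letters came after everything the others
  -- have done.
  refine ⟨Atm.wreath T₁ T₂, .wreath _ _ hT₁ hT₂,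
    fun s => (g fun i => (s i).1).1.1 (f fun i => (s i).2), fun x => ?_, ?_⟩
  · obtain ⟨s, hs⟩ := hg 1
    obtain ⟨s', rfl⟩ := hf x
    refine ⟨fun i => (s i, s' i), ?_⟩
    change (g s).1.1 (f s') = _
    rw [hs]
    rfl
  rintro ⟨L, m⟩ hm
  by_cases hℓ : ℓ ∈ L
  · rcases Set.eq_empty_or_nonempty (L \ {ℓ}) with hL | hL
    · have hL' : L = {ℓ} := subset_antisymm (Set.sdiff_eq_empty.1 hL) (by simpa using hℓ)
      subst hL'
      obtain ⟨t, ht, htm⟩ := H₁ _ (Or.inl ⟨⟨m, Submonoid.subset_closure hm⟩, trivial, rfl⟩)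
      refine ⟨_, ⟨⟨t, ht⟩, fun _ => 1, rfl⟩, isPMap_wreath subset_rfl
        (isPMap_of_subsingleton hℓ hs t) (fun _ => isPMap_one _) (fun _ _ _ => rfl), fun s => ?_⟩
      change (g (t _)).1.1 (f _) = _
      rw [htm]
      rfl
    -- Communication: `ℓ` resets to `1`, and the second factor executes `k * m` for the `k` read
    -- from the old state.
    · obtain ⟨t, ht, htm⟩ := H₁ _ (Or.inr ⟨1, rfl⟩)
      choose r hr hrL hrm using fun k : localSubmonoid Φ ℓ =>
        H₂ (L \ {ℓ}, k.1 * m) ⟨hL, _, hm, rfl, Or.inr ⟨hℓ, k.1, k.2, rfl⟩⟩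
      refine ⟨_, ⟨⟨t, ht⟩, fun s => ⟨r (g s), hr _⟩, rfl⟩, isPMap_wreath Set.sdiff_subset
        (isPMap_of_subsingleton hℓ hs t) (fun _ => hrL _)
        (fun s s' h => by rw [hgℓ s s' (h ℓ hℓ)]), fun s => ?_⟩
      change (g (t _)).1.1 (f (r _ _)) = _
      rw [htm, hrm]
      rfl
  · obtain ⟨t, ht, htL, htm⟩ := H₂ (L, m)
      ⟨hne _ hm, _, hm, (Set.sdiff_singleton_eq_self hℓ).symm, Or.inl ⟨hℓ, rfl⟩⟩
    refine ⟨_, ⟨1, fun _ => ⟨t, ht⟩, rfl⟩, isPMap_wreath subset_rfl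
        (isPMap_one _) (fun _ => htL) (fun _ _ _ => rfl), fun s => ?_⟩
    change (g _).1.1 (f (t _)) = m.1 ((g _).1.1 (f _))
    rw [htm]
    -- A letter avoiding `ℓ` is moved past the pending element.
    have := localSubmonoid_commute hΦ (g fun i => (s i).1).2 hm hℓ
    exact congrFun (congrArg Subtype.val this.eq.symm) _

/-- If at most one of two letters involves `ℓ`, removing `ℓ` does not affect disjointness of their
locations; if both do, `hℓ` rules out disjoint remainders. -/
theorem eliminate_commute {Φ : Set (Set P × M)} {ℓ : P}
    (hΦ : ∀ a ∈ Φ, ∀ b ∈ Φ, Disjoint a.1 b.1 → Commute a.2 b.2)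
    (hℓ : ∀ a ∈ Φ, ∀ b ∈ Φ, ℓ ∈ a.1 → ℓ ∈ b.1 → (a.1 \ {ℓ}).Nonempty → (b.1 \ {ℓ}).Nonempty →
      ¬Disjoint (a.1 \ {ℓ}) (b.1 \ {ℓ})) :
    ∀ a ∈ eliminate Φ ℓ, ∀ b ∈ eliminate Φ ℓ, Disjoint a.1 b.1 → Commute a.2 b.2 := by
  have key : ∀ a ∈ Φ, ∀ b ∈ Φ, ℓ ∈ a.1 → ℓ ∉ b.1 → ∀ k ∈ localSubmonoid Φ ℓ,
      Disjoint (a.1 \ {ℓ}) (b.1 \ {ℓ}) → Commute (k * a.2) b.2 := by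
    intro a ha b hb hla hlb k hk hd
    refine (localSubmonoid_commute hΦ hk hb hlb).mul_left (hΦ a ha b hb ?_)
    rw [Set.disjoint_left] at hd ⊢
    intro i hi hi'
    have hne : i ≠ ℓ := by
      rintro rfl
      exact hlb hi'
    exact hd ⟨hi, hne⟩ ⟨hi', hne⟩
  rintro ⟨L, m⟩ ⟨hL, a, ha, rfl, ⟨hla, rfl⟩ | ⟨hla, k, hk, rfl⟩⟩ ⟨L', m'⟩
    ⟨hL', b, hb, rfl, ⟨hlb, rfl⟩ | ⟨hlb, k', hk', rfl⟩⟩ hd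
  · refine hΦ a ha b hb ?_
    simpa only [Set.sdiff_singleton_eq_self hla, Set.sdiff_singleton_eq_self hlb] using hd
  · exact (key b hb a ha hlb hla k' hk' hd.symm).symm
  · exact key a ha b hb hla hlb k hk hd
  · exact (hℓ a ha b hb hla hlb hL hL' hd).elim

/-- The set `P` stays fixed and only the set `Q` of active processes shrinks. Locations are cliques,
so a location that properly contains the leaf `ℓ` also contains its unique neighbour in `Q`. -/
theorem realizable_of_isAcyclic [Nonempty P] {C : Atm P → Prop} [Finite X] [Nonempty X]
    (hU : ∀ p, C (Atm.localized p (Fin 2) U₂))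
    (hG : ∀ (p : P) (H : Type w) [Group H] [Finite H], IsSimpleGroup H → Divides H M →
      LocallyRealizable C p (regular H : Set (Transf H)))
    (G : SimpleGraph P) (hac : G.IsAcyclic) (Q : Finset P) :
    ∀ Φ : Set (Set P × M), (∀ a ∈ Φ, a.1.Nonempty ∧ a.1 ⊆ Q ∧ G.IsClique a.1) →
      (∀ a ∈ Φ, ∀ b ∈ Φ, Disjoint a.1 b.1 → Commute a.2 b.2) → Realizable C Φ := by
  classical
  induction Q using Finset.strongInduction with
  | H Q ih =>
    intro Φ hQ hΦ
    rcases Q.eq_empty_or_nonempty with rfl | hQne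
    -- No letters remain; only some wreath product with a surjection onto `X` is needed.
    · obtain ⟨T, hT, -, f, hf, -⟩ := locallyRealizable_resets (hU (Classical.arbitrary P)) X
      refine ⟨T, hT, f, hf, fun a ha => ?_⟩
      obtain ⟨⟨i, hi⟩, h, -⟩ := hQ a ha
      simpa using h hi
    · obtain ⟨ℓ, hℓQ, hℓ⟩ := exists_leaf_finset G hac hQne
      have : Finite (Transf X) := inferInstanceAs (Finite (X → X))
      have : Finite M := inferInstance
      refine Realizable.of_eliminate (ℓ := ℓ) (fun a ha => (hQ a ha).1) hΦ ?_ ?_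
      · exact locallyRealizable_mulResets (hU ℓ) _ _ _ _ le_rfl le_rfl (by simp)
          fun H _ _ hH hd => hG ℓ H hH (hd.trans (Divides.of_submonoid _))
      · refine ih (Q.erase ℓ) (Finset.erase_ssubset hℓQ) _ ?_ (eliminate_commute hΦ ?_)
        · rintro ⟨L, m⟩ ⟨hL, a, ha, rfl, -⟩
          refine ⟨hL, fun i hi => ?_, (hQ a ha).2.2.subset Set.sdiff_subset⟩
          simpa using And.intro ((hQ a ha).2.1 hi.1) hi.2
        · rintro a ha b hb hla hlb ⟨i, hi⟩ ⟨j, hj⟩ hd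
          have hij : i = j := hℓ i ((hQ a ha).2.1 hi.1) j ((hQ b hb).2.1 hj.1)
            ((hQ a ha).2.2 hla hi.1 (Ne.symm hi.2)) ((hQ b hb).2.2 hlb hj.1 (Ne.symm hj.2))
          exact Set.disjoint_left.1 hd hi (hij ▸ hj)

end Realizable

/-! ### From letters to traces -/

theorem Divides.of_mulEquiv {G H M : Type*} [Monoid G] [Monoid H] [Monoid M] (e : G ≃* H)
    (h : Divides G M) : Divides H M :=
  (Divides.of_surjective e.toMonoidHom e.surjective).trans h

/-- Factors have states in `Type`, so a finite group from another universe is replaced by a small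
copy. -/
theorem locallyRealizable_isKRFactor {P : Type u} {M : Type w} [Monoid M] (p : P) (H : Type v)
    [Group H] [Finite H] (hH : IsSimpleGroup H) (hd : Divides H M) :
    LocallyRealizable (Atm.IsKRFactor M) p (regular H : Set (Transf H)) := by
  let e : Shrink.{0} H ≃* H := Shrink.mulEquiv
  have : Finite (Shrink.{0} H) := Finite.of_equiv H e.symm.toEquiv
  have hs : IsSimpleGroup (Shrink.{0} H) := e.isSimpleGroup
  have := LocallyRealizable.localized (C := Atm.IsKRFactor M) (p := p) (regular (Shrink.{0} H))
    (Or.inr ⟨p, _, _, this, hs, hd.of_mulEquiv e.symm, rfl⟩)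
  refine this.of_surjective e e.surjective ?_
  rintro _ ⟨g, rfl⟩
  exact ⟨_, ⟨e.symm g, rfl⟩, fun x => (map_mul e _ _).trans (by rw [e.apply_symm_apply]; rfl)⟩

theorem DistributedAlphabet.letter_commute {P : Type u} {A : Type v}
    (D : DistributedAlphabet P A) {a b : A} (h : D.Indep a b) :
    Commute (D.letter a) (D.letter b) :=
  PresentedMonoid.mk_eq_mk_of_rel (rels := D.commRel) ⟨a, b, h, rfl, rfl⟩

end AsyncKR

theorem theorem4p1 {P : Type u} [Finite P] [Nonempty P] {A : Type v}
    (D : AsyncKR.DistributedAlphabet P A) (hD : D.communicationGraph.IsAcyclic) :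
    AsyncKR.DistributedAlphabet.HasAsyncKRProperty.{u, v, w} D := by
  intro X _ _ M φ
  have := Fintype.ofFinite P
  obtain ⟨T, hT, f, hf, H⟩ := AsyncKR.realizable_of_isAcyclic (M := M)
    (C := AsyncKR.Atm.IsKRFactor M) (fun p => Or.inl ⟨p, rfl⟩)
    (fun p H _ _ hH hd => AsyncKR.locallyRealizable_isKRFactor p H hH hd)
    D.communicationGraph hD Finset.univ (Set.range fun a => (D.loc a, φ (D.letter a)))
    (by
      rintro _ ⟨a, rfl⟩
      exact ⟨D.cover a, by simp, fun i hi j hj hij => ⟨hij, a, hi, hj⟩⟩)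
    (by
      rintro _ ⟨a, rfl⟩ _ ⟨b, rfl⟩ h
      exact (D.letter_commute h).map φ)
  choose t ht htP htf using fun a => H _ ⟨a, rfl⟩
  have := T.nonempty
  refine ⟨T, hT, PresentedMonoid.lift (fun a => (⟨t a, ht a⟩ : T.M)) ?_, fun a => htP a,
    f, hf, fun a => htf a⟩
  rintro _ _ ⟨a, b, hab, rfl, rfl⟩
  simp only [map_mul, FreeMonoid.lift_eval_of]
  exact Subtype.ext ((htP a).mul_comm (htP b) hab)
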